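/- Let $\mathbb{C}_+=\{w\in\mathbb{C}:\operatorname{Re} w>0\}$ and let $H^2(\mathbb{C}_+)$ be the Hilbert space of holomorphic functions $f$ on $\mathbb{C}_+$ with $$\|f\|=\Bigl(\sup_{x>0}\frac1\pi\int_{-\infty}^{\infty}|f(x+iy)|^2\,dy\Bigr)^{1/2}<\infty .$$ For a self-map $\phi$ of $\mathbb{C}_+$ write $C_\phi f=f\circ\phi$. A conjugation on a complex Hilbert space $\mathcal H$ is a conjugate-linear map $C:\mathcal H\to\mathcal H$ with $C^2=I$ and $\langle Cx,Cy\rangle=\langle y,x\rangle$ for all $x,y\in\mathcal H$; a bounded operator $T$ on $\mathcal H$ is $C$-symmetric if $C$ is a conjugation and $CT^*C=T$. Let $$(W_0f)(w)=\frac1w\,\overline{f\!\left(\frac1{\overline w}\right)},\qquad f\in H^2(\mathbb{C}_+),\ w\in\mathbb{C}_+,$$ which maps $H^2(\mathbb{C}_+)$ into itself. Let $\phi(w)=aw+b$ with $a\in(0,1)\cup(1,\infty)$ and $\operatorname{Re}b=0$, let $\tau(w)=w+(1-a)^{-1}b$, and let $W_{a,b}=C_\tau^{-1}W_0C_\tau$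 on $H^2(\mathbb{C}_+)$. Then (a) $W_{a,b}$ is a conjugation on $H^2(\mathbb{C}_+)$; (b) $C_\phi$ is $W_{a,b}$-symmetric on $H^2(\mathbb{C}_+)$. -/

import Mathlib

open MeasureTheory Set Filter Topology
open scoped ENNReal ComplexConjugate

/-- The open right half-plane. -/
def rightHalfPlane : Set ℂ := {w | 0 < w.re}

/-- The square of the Hardy norm on the right half-plane, with values in `[0, ∞]`. -/
noncomputable def hardySq (f : ℂ → ℂ) : ℝ≥0∞ :=
  ⨆ (x : ℝ) (_ : 0 < x), ENNReal.ofReal (1 / Real.pi) * ∫⁻ y : ℝ, ‖f (x + y * Complex.I)‖ₑ ^ 2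

/-- The property of being a member of the Hardy space; a function on the right half-plane is
encoded as its extension by zero to the whole plane. -/
structure MemHardy (f : ℂ → ℂ) : Prop where
  diff : DifferentiableOn ℂ f rightHalfPlane
  zero_of_notMem : ∀ w, w ∉ rightHalfPlane → f w = 0
  finite : hardySq f < ⊤

namespace HardyAux

/-- The unnormalised square integral over the vertical line through `x`. -/
noncomputable def sl (f : ℂ → ℂ) (x : ℝ) : ℝ≥0∞ := ∫⁻ y : ℝ, ‖f (x + y * Complex.I)‖ₑ ^ 2

lemma isOpen_rhp : IsOpen rightHalfPlane := isOpen_lt continuous_const Complex.continuous_re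

lemma mem_rhp {x : ℝ} (hx : 0 < x) (y : ℝ) : (x + y * Complex.I : ℂ) ∈ rightHalfPlane := by
  simpa [rightHalfPlane] using hx

lemma hardySq_eq (f : ℂ → ℂ) :
    hardySq f = ENNReal.ofReal (1 / Real.pi) * ⨆ x : Ioi (0 : ℝ), sl f x := by
  rw [ENNReal.mul_iSup, iSup_subtype]
  rfl

lemma c_ne_zero : ENNReal.ofReal (1 / Real.pi) ≠ 0 := by
  have := Real.pi_pos
  simp [this]

lemma sl_le {f : ℂ → ℂ} {x : ℝ} (hx : 0 < x) :
    sl f x ≤ ENNReal.ofReal Real.pi * hardySq f := by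
  rw [hardySq_eq, ← mul_assoc, ← ENNReal.ofReal_mul Real.pi_pos.le,
    mul_one_div_cancel Real.pi_pos.ne', ENNReal.ofReal_one, one_mul]
  exact le_iSup (fun x : Ioi (0 : ℝ) => sl f x) ⟨x, hx⟩

lemma sl_lt_top {f : ℂ → ℂ} (hf : MemHardy f) {x : ℝ} (hx : 0 < x) : sl f x < ⊤ :=
  (sl_le hx).trans_lt (ENNReal.mul_lt_top ENNReal.ofReal_lt_top hf.finite)

lemma cont_line {f : ℂ → ℂ} (hf : DifferentiableOn ℂ f rightHalfPlane) {w : ℂ} (hw : 0 < w.re) :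
    Continuous fun y : ℝ => f (w + y * Complex.I) := by
  refine hf.continuousOn.comp_continuous (by fun_prop) fun y => ?_
  simpa [rightHalfPlane] using hw

lemma sl_translate (f : ℂ → ℂ) (w : ℂ) :
    ∫⁻ y : ℝ, ‖f (w + y * Complex.I)‖ₑ ^ 2 = sl f w.re := by
  rw [sl, ← lintegral_add_right_eq_self (fun y : ℝ => ‖f (w.re + y * Complex.I)‖ₑ ^ 2) w.im]
  refine lintegral_congr fun y => ?_
  congr 3
  apply Complex.ext <;> simp [add_comm]

lemma holder_aux {R : ℝ} {u v : ℝ → ℂ} (hu : Continuous u) (hv : Continuous v) :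
    ‖∫ y in (-R)..R, u y * v y‖ₑ ≤
      (∫⁻ y, ‖u y‖ₑ ^ 2) ^ (1 / 2 : ℝ) * (∫⁻ y in uIoc (-R) R, ‖v y‖ₑ ^ 2) ^ (1 / 2 : ℝ) := by
  have h2 : Real.HolderConjugate 2 2 := Real.HolderConjugate.two_two
  calc ‖∫ y in (-R)..R, u y * v y‖ₑ = ‖∫ y in uIoc (-R) R, u y * v y‖ₑ := by
        rw [enorm_eq_iff_norm_eq, intervalIntegral.norm_intervalIntegral_eq]
    _ ≤ ∫⁻ y in uIoc (-R) R, ‖u y * v y‖ₑ := enorm_integral_le_lintegral_enorm _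
    _ = ∫⁻ y in uIoc (-R) R, ((fun y => ‖u y‖ₑ) * fun y => ‖v y‖ₑ) y := by simp [enorm_mul]
    _ ≤ _ := by
        refine (ENNReal.lintegral_mul_le_Lp_mul_Lq _ h2 ?_ ?_).trans ?_
        · exact hu.enorm.aemeasurable
        · exact hv.enorm.aemeasurable
        · simp only [ENNReal.rpow_ofNat]
          gcongr
          exact Measure.restrict_le_self

lemma conv_diff {f : ℂ → ℂ} (hf : DifferentiableOn ℂ f rightHalfPlane) {v : ℝ → ℂ}
    (hv : Continuous v) (R : ℝ) {w : ℂ} (hw : 0 < w.re) :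
    DifferentiableAt ℂ (fun z => ∫ y in (-R)..R, f (z + y * Complex.I) * v y) w := by
  have hder : DifferentiableOn ℂ (deriv f) rightHalfPlane := hf.deriv isOpen_rhp
  have hcompact : IsCompact ((fun p : ℂ × ℝ => p.1 + p.2 * Complex.I) ''
      (Metric.closedBall w (w.re / 2) ×ˢ uIcc (-R) R)) :=
    ((isCompact_closedBall _ _).prod isCompact_uIcc).image (by fun_prop)
  have hball : ∀ z ∈ Metric.closedBall w (w.re / 2), 0 < z.re := by
    intro z hz
    have h1 := Complex.abs_re_le_norm (z - w)
    rw [Metric.mem_closedBall, dist_eq_norm] at hz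
    rw [Complex.sub_re] at h1
    have := (abs_le.1 (h1.trans hz)).1
    linarith
  have hsub : ((fun p : ℂ × ℝ => p.1 + p.2 * Complex.I) ''
      (Metric.closedBall w (w.re / 2) ×ˢ uIcc (-R) R)) ⊆ rightHalfPlane := by
    rintro _ ⟨⟨z, y⟩, ⟨hz, -⟩, rfl⟩
    simpa [rightHalfPlane] using hball z hz
  obtain ⟨B, hB⟩ := hcompact.exists_bound_of_continuousOn (hder.continuousOn.mono hsub)
  have hs : Metric.closedBall w (w.re / 2) ∈ 𝓝 w := Metric.closedBall_mem_nhds _ (by linarith)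
  refine (intervalIntegral.hasDerivAt_integral_of_dominated_loc_of_deriv_le
    (F := fun z y => f (z + y * Complex.I) * v y)
    (F' := fun z y => deriv f (z + y * Complex.I) * v y) (bound := fun y => B * ‖v y‖)
    hs ?_ ?_ ?_ ?_ ?_ ?_).2.differentiableAt
  · filter_upwards [hs] with z hz
    exact ((cont_line hf (hball z hz)).mul hv).aestronglyMeasurable
  · exact ((cont_line hf hw).mul hv).intervalIntegrable _ _
  · exact ((cont_line hder hw).mul hv).aestronglyMeasurable
  · refine Eventually.of_forall fun y hy z hz => ?_
    rw [norm_mul]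
    gcongr
    exact hB _ ⟨(z, y), ⟨hz, uIoc_subset_uIcc hy⟩, rfl⟩
  · exact (continuous_const.mul hv.norm).intervalIntegrable _ _
  · refine Eventually.of_forall fun y hy z hz => ?_
    have hmem : z + y * Complex.I ∈ rightHalfPlane := by
      simpa [rightHalfPlane] using hball z hz
    have h1 := (hf.differentiableAt (isOpen_rhp.mem_nhds hmem)).hasDerivAt
    exact (h1.comp_add_const z (y * Complex.I)).mul_const _

/-- The square integrals over vertical lines decrease from left to right. -/
lemma sl_anti {f : ℂ → ℂ} (hf : MemHardy f) {x₀ x : ℝ} (h₀ : 0 < x₀) (hx : x₀ ≤ x) :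
    sl f x ≤ sl f x₀ := by
  have hxp : 0 < x := h₀.trans_le hx
  have hxc : Continuous fun y : ℝ => f (x + y * Complex.I) :=
    cont_line hf.diff (w := (x : ℂ)) (by simpa using hxp)
  have key : ∀ n : ℕ, ∫⁻ y in Ioc (-(n : ℝ)) n, ‖f (x + y * Complex.I)‖ₑ ^ 2 ≤ sl f x₀ := by
    intro n
    obtain ⟨R, hR⟩ : ∃ R : ℝ, R = (n : ℝ) := ⟨_, rfl⟩
    have hRR : -R ≤ R := by
      have : (0 : ℝ) ≤ R := hR ▸ Nat.cast_nonneg n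
      linarith
    rw [← hR]
    set v : ℝ → ℂ := fun y => conj (f (x + y * Complex.I)) with hv
    have hvc : Continuous v := Complex.continuous_conj.comp hxc
    set A : ℝ≥0∞ := ∫⁻ y in Ioc (-R) R, ‖f (x + y * Complex.I)‖ₑ ^ 2 with hA
    have hAtop : A ≠ ⊤ := ((setLIntegral_le_lintegral _ _).trans_lt (sl_lt_top hf hxp)).ne
    have hvA : ∫⁻ y in uIoc (-R) R, ‖v y‖ₑ ^ 2 = A := by
      rw [uIoc_of_le hRR]
      simp [hA, hv]
    set F : ℂ → ℂ := fun z => ∫ y in (-R)..R, f (z + y * Complex.I) * v y with hF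
    have hFb : ∀ z : ℂ, 0 < z.re → ‖F z‖ₑ ≤ sl f z.re ^ (1 / 2 : ℝ) * A ^ (1 / 2 : ℝ) := by
      intro z hz
      refine (holder_aux (cont_line hf.diff hz) hvc).trans ?_
      rw [hvA, sl_translate]
    have hFx : ‖F x‖ₑ = A := by
      have h1 : F x = ((∫ y in Ioc (-R) R, ‖f (x + y * Complex.I)‖ ^ 2 : ℝ) : ℂ) := by
        simp only [hF, hv]
        rw [intervalIntegral.integral_of_le hRR, ← integral_complex_ofReal]
        refine integral_congr_ae (Eventually.of_forall fun y => ?_)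
        simp [Complex.mul_conj, Complex.normSq_eq_norm_sq]
      have h0 : 0 ≤ ∫ y in Ioc (-R) R, ‖f (x + y * Complex.I)‖ ^ 2 :=
        integral_nonneg fun y => by positivity
      rw [h1, ← ofReal_norm, Complex.norm_real, Real.norm_of_nonneg h0,
        ofReal_integral_eq_lintegral_ofReal]
      · refine lintegral_congr fun y => ?_
        rw [ENNReal.ofReal_pow (norm_nonneg _), ofReal_norm]
      · exact ((hxc.norm.pow 2).integrableOn_Icc).mono_set Ioc_subset_Icc_self
      · exact Eventually.of_forall fun y => by positivity
    have hP : ENNReal.ofReal Real.pi * hardySq f ≠ ⊤ :=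
      ENNReal.mul_ne_top ENNReal.ofReal_ne_top hf.finite.ne
    have toR : ∀ {z : ℂ} {S : ℝ≥0∞}, S ≠ ⊤ → ‖F z‖ₑ ≤ S ^ (1 / 2 : ℝ) * A ^ (1 / 2 : ℝ) →
        ‖F z‖ ≤ (S ^ (1 / 2 : ℝ) * A ^ (1 / 2 : ℝ)).toReal := by
      intro z S hS h
      rw [← toReal_enorm]
      exact ENNReal.toReal_mono (ENNReal.mul_ne_top
        (ENNReal.rpow_ne_top_of_nonneg (by norm_num) hS)
        (ENNReal.rpow_ne_top_of_nonneg (by norm_num) hAtop)) h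
    have hbd : ∀ z : ℂ, 0 < z.re → ‖F z‖ ≤
        ((ENNReal.ofReal Real.pi * hardySq f) ^ (1 / 2 : ℝ) * A ^ (1 / 2 : ℝ)).toReal := by
      intro z hz
      refine toR hP ((hFb z hz).trans ?_)
      gcongr
      exact sl_le hz
    have hPL : ‖F (x₀ + ((x - x₀ : ℝ) : ℂ))‖ ≤
        (sl f x₀ ^ (1 / 2 : ℝ) * A ^ (1 / 2 : ℝ)).toReal := by
      refine PhragmenLindelof.right_half_plane_of_bounded_on_real
        (f := fun z : ℂ => F (x₀ + z)) ?_ ?_ ?_ ?_ ?_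
      · refine DifferentiableOn.diffContOnCl fun z hz => ?_
        rw [Complex.closure_setOfPred_lt_re] at hz
        have : 0 < ((x₀ : ℂ) + z).re := by
          have : 0 ≤ z.re := hz
          simp; linarith
        have h1 := conv_diff hf.diff hvc R this
        exact (DifferentiableAt.comp z h1
          ((differentiableAt_const _).add differentiableAt_id)).differentiableWithinAt
      · refine ⟨0, by norm_num, 0, Asymptotics.IsBigO.of_bound
          ((ENNReal.ofReal Real.pi * hardySq f) ^ (1 / 2 : ℝ) * A ^ (1 / 2 : ℝ)).toReal ?_⟩
        refine Filter.Eventually.filter_mono inf_le_right ?_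
        refine eventually_principal.2 fun z hz => ?_
        have : 0 < ((x₀ : ℂ) + z).re := by
          have : 0 < z.re := hz
          simp; linarith
        simpa using hbd _ this
      · refine ⟨((ENNReal.ofReal Real.pi * hardySq f) ^ (1 / 2 : ℝ) * A ^ (1 / 2 : ℝ)).toReal, ?_⟩
        rw [eventually_map]
        filter_upwards [eventually_ge_atTop (0 : ℝ)] with t ht
        refine hbd _ ?_
        simp; linarith
      · intro t
        refine toR (sl_lt_top hf h₀).ne ((hFb _ (by simpa using h₀)).trans ?_)
        simp
      · simpa using hx
    have e1 : ((x₀ : ℂ) + ((x - x₀ : ℝ) : ℂ)) = x := by push_cast; ring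
    rw [e1] at hPL
    have hle : A ≤ sl f x₀ ^ (1 / 2 : ℝ) * A ^ (1 / 2 : ℝ) := by
      have h3 := ENNReal.ofReal_le_ofReal hPL
      rwa [ofReal_norm, hFx, ENNReal.ofReal_toReal] at h3
      exact ENNReal.mul_ne_top
        (ENNReal.rpow_ne_top_of_nonneg (by norm_num) (sl_lt_top hf h₀).ne)
        (ENNReal.rpow_ne_top_of_nonneg (by norm_num) hAtop)
    by_cases hA0 : A = 0
    · rw [hA0]; exact zero_le
    have hhalf : A = A ^ (1 / 2 : ℝ) * A ^ (1 / 2 : ℝ) := by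
      rw [← ENNReal.rpow_add _ _ hA0 hAtop]; norm_num
    have hAh0 : A ^ (1 / 2 : ℝ) ≠ 0 := by simp [hA0]
    have hAht : A ^ (1 / 2 : ℝ) ≠ ⊤ := ENNReal.rpow_ne_top_of_nonneg (by norm_num) hAtop
    have h4 : A ^ (1 / 2 : ℝ) ≤ sl f x₀ ^ (1 / 2 : ℝ) := by
      rw [← ENNReal.mul_le_mul_iff_left hAh0 hAht, ← hhalf]; exact hle
    exact (ENNReal.rpow_le_rpow_iff (by norm_num)).1 h4
  have hcov : AECover (volume : Measure ℝ) atTop fun n : ℕ => Ioc (-(n : ℝ)) n :=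
    aecover_Ioc (tendsto_neg_atTop_atBot.comp tendsto_natCast_atTop_atTop)
      tendsto_natCast_atTop_atTop
  exact le_of_tendsto' (hcov.lintegral_tendsto_of_countably_generated
    (hxc.enorm.measurable.pow_const 2).aemeasurable) key

lemma sl_parallelogram {f g : ℂ → ℂ} (hf : MemHardy f) (hg : MemHardy g) {x : ℝ} (hx : 0 < x) :
    sl (f + g) x + sl (f - g) x = 2 * (sl f x + sl g x) := by
  have hfc : Continuous fun y : ℝ => f (x + y * Complex.I) :=
    cont_line hf.diff (w := (x : ℂ)) (by simpa using hx)
  have hgc : Continuous fun y : ℝ => g (x + y * Complex.I) :=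
    cont_line hg.diff (w := (x : ℂ)) (by simpa using hx)
  simp only [sl, Pi.add_apply, Pi.sub_apply]
  have hm1 : Measurable fun y : ℝ => ‖f (x + y * Complex.I) + g (x + y * Complex.I)‖ₑ ^ 2 :=
    (hfc.add hgc).enorm.measurable.pow_const 2
  have hm2 : Measurable fun y : ℝ => ‖f (x + y * Complex.I)‖ₑ ^ 2 :=
    hfc.enorm.measurable.pow_const 2
  have hm3 : Measurable fun y : ℝ => ‖g (x + y * Complex.I)‖ₑ ^ 2 :=
    hgc.enorm.measurable.pow_const 2
  rw [← lintegral_add_left hm1, ← lintegral_add_left hm2, ← lintegral_const_mul]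
  · refine lintegral_congr fun y => ?_
    simp only [← ofReal_norm]
    rw [← ENNReal.ofReal_pow (norm_nonneg _), ← ENNReal.ofReal_pow (norm_nonneg _),
      ← ENNReal.ofReal_pow (norm_nonneg _), ← ENNReal.ofReal_pow (norm_nonneg _),
      ← ENNReal.ofReal_add (by positivity) (by positivity),
      ← ENNReal.ofReal_add (by positivity) (by positivity),
      show (2 : ℝ≥0∞) = ENNReal.ofReal 2 by simp, ← ENNReal.ofReal_mul (by norm_num)]
    congr 1
    have := parallelogram_law_with_norm ℝ (f (x + y * Complex.I)) (g (x + y * Complex.I))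
    nlinarith [this]
  · exact hm2.add hm3

lemma hardySq_smul (c : ℂ) (f : ℂ → ℂ) : hardySq (c • f) = ‖c‖ₑ ^ 2 * hardySq f := by
  have : ∀ x, sl (c • f) x = ‖c‖ₑ ^ 2 * sl f x := by
    intro x
    simp only [sl, Pi.smul_apply, smul_eq_mul, enorm_mul, mul_pow]
    exact lintegral_const_mul' _ _ (by simp)
  simp only [hardySq_eq, this]
  rw [← ENNReal.mul_iSup]
  ring

lemma memHardy_smul (c : ℂ) {f : ℂ → ℂ} (hf : MemHardy f) : MemHardy (c • f) where
  diff := hf.diff.const_smul c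
  zero_of_notMem w hw := by simp [hf.zero_of_notMem w hw]
  finite := by
    rw [hardySq_smul]
    exact ENNReal.mul_lt_top (by simp) hf.finite

lemma memHardy_add {f g : ℂ → ℂ} (hf : MemHardy f) (hg : MemHardy g) : MemHardy (f + g) where
  diff := hf.diff.add hg.diff
  zero_of_notMem w hw := by simp [hf.zero_of_notMem w hw, hg.zero_of_notMem w hw]
  finite := by
    have h : ∀ x : Ioi (0 : ℝ), sl (f + g) x ≤
        2 * (ENNReal.ofReal Real.pi * hardySq f + ENNReal.ofReal Real.pi * hardySq g) := by
      intro x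
      calc sl (f + g) x ≤ sl (f + g) x + sl (f - g) x := le_self_add
        _ = 2 * (sl f x + sl g x) := sl_parallelogram hf hg x.2
        _ ≤ _ := by gcongr <;> exact sl_le x.2
    rw [hardySq_eq]
    refine ENNReal.mul_lt_top ENNReal.ofReal_lt_top ((iSup_le h).trans_lt ?_)
    refine ENNReal.mul_lt_top (by simp) (ENNReal.add_lt_top.2 ⟨?_, ?_⟩)
    · exact ENNReal.mul_lt_top ENNReal.ofReal_lt_top hf.finite
    · exact ENNReal.mul_lt_top ENNReal.ofReal_lt_top hg.finite

lemma memHardy_zero : MemHardy 0 where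
  diff := differentiableOn_const 0
  zero_of_notMem _ _ := rfl
  finite := by simp [hardySq]

lemma hardySq_parallelogram {f g : ℂ → ℂ} (hf : MemHardy f) (hg : MemHardy g) :
    hardySq (f + g) + hardySq (f - g) = 2 * (hardySq f + hardySq g) := by
  have hs : MemHardy (f - g) := by
    have := memHardy_add hf (memHardy_smul (-1) hg)
    simpa [sub_eq_add_neg] using this
  have hdir : ∀ {u v : ℂ → ℂ}, MemHardy u → MemHardy v →
      (⨆ x : Ioi (0 : ℝ), sl u x) + (⨆ x : Ioi (0 : ℝ), sl v x)
        = ⨆ x : Ioi (0 : ℝ), (sl u x + sl v x) := by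
    intro u v hu hv
    refine ENNReal.iSup_add_iSup fun i j => ⟨⟨min i.1 j.1, lt_min (mem_Ioi.1 i.2) (mem_Ioi.1 j.2)⟩, ?_⟩
    have hi : 0 < i.1 := i.2
    have hj : 0 < j.1 := j.2
    exact add_le_add (sl_anti hu (lt_min hi hj) (min_le_left _ _))
      (sl_anti hv (lt_min hi hj) (min_le_right _ _))
  simp only [hardySq_eq]
  rw [← mul_add, hdir (memHardy_add hf hg) hs, ← mul_add, hdir hf hg, mul_left_comm]
  congr 1
  rw [ENNReal.mul_iSup]
  exact iSup_congr fun x => sl_parallelogram hf hg x.2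

end HardyAux

namespace HardyAux

lemma measurable_memHardy {f : ℂ → ℂ} (hf : MemHardy f) : Measurable f := by
  classical
  have h : f = rightHalfPlane.piecewise f 0 := by
    ext w
    by_cases hw : w ∈ rightHalfPlane
    · simp [hw]
    · simp [hw, hf.zero_of_notMem w hw]
  rw [h]
  exact hf.diff.continuousOn.measurable_piecewise continuousOn_const isOpen_rhp.measurableSet

lemma circle_le {f : ℂ → ℂ} (hf : MemHardy f) {w : ℂ} {r : ℝ} (hr : 0 < r) (hrw : r < w.re) :
    ENNReal.ofReal (2 * Real.pi) * ‖f w‖ₑ ^ 2 ≤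
      ∫⁻ θ in Ioo (-Real.pi) Real.pi, ‖f (w + r * (Real.cos θ + Real.sin θ * Complex.I))‖ₑ ^ 2 := by
  have hd : DiffContOnCl ℂ (fun z => f z ^ 2) (Metric.ball w |r|) := by
    refine DifferentiableOn.diffContOnCl ((hf.diff.pow 2).mono ?_)
    intro z hz
    rw [abs_of_pos hr] at hz
    have hz := Metric.closure_ball_subset_closedBall hz
    rw [Metric.mem_closedBall, dist_eq_norm] at hz
    have h1 := (abs_le.1 ((Complex.abs_re_le_norm (z - w)).trans hz)).1
    rw [Complex.sub_re] at h1
    change 0 < z.re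
    linarith
  have h1 := hd.circleAverage
  rw [Real.circleAverage_eq_integral_add (-Real.pi)] at h1
  rw [intervalIntegral.integral_comp_add_right (fun θ => f (circleMap w r θ) ^ 2)] at h1
  rw [show (0 : ℝ) + -Real.pi = -Real.pi by ring,
    show 2 * Real.pi + -Real.pi = Real.pi by ring] at h1
  have hpi : (0 : ℝ) < 2 * Real.pi := by positivity
  have h2 : ∫ θ in (-Real.pi)..Real.pi, f (circleMap w r θ) ^ 2
      = (2 * Real.pi) • f w ^ 2 := by
    rw [← h1, smul_smul, mul_inv_cancel₀ hpi.ne', one_smul]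
  calc ENNReal.ofReal (2 * Real.pi) * ‖f w‖ₑ ^ 2 = ‖(2 * Real.pi) • f w ^ 2‖ₑ := by
        rw [enorm_smul, enorm_pow, Real.enorm_eq_ofReal hpi.le]
    _ = ‖∫ θ in Ioo (-Real.pi) Real.pi, f (circleMap w r θ) ^ 2‖ₑ := by
        rw [← h2, intervalIntegral.integral_of_le (by linarith), integral_Ioc_eq_integral_Ioo]
    _ ≤ ∫⁻ θ in Ioo (-Real.pi) Real.pi, ‖f (circleMap w r θ) ^ 2‖ₑ :=
        enorm_integral_le_lintegral_enorm _
    _ = _ := by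
        refine lintegral_congr fun θ => ?_
        rw [enorm_pow, circleMap, Complex.exp_mul_I, Complex.ofReal_cos, Complex.ofReal_sin]

lemma point_bound {f : ℂ → ℂ} (hf : MemHardy f) {w : ℂ} {R : ℝ} (hR : 0 < R) (hRw : R < w.re) :
    ENNReal.ofReal (R ^ 2 * Real.pi) * ‖f w‖ₑ ^ 2 ≤
      ENNReal.ofReal (2 * R * Real.pi) * hardySq f := by
  set G : ℂ → ℝ≥0∞ := (Metric.ball (0 : ℂ) R).indicator fun z => ‖f (w + z)‖ₑ ^ 2 with hG
  have hfm := measurable_memHardy hf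
  have hGm : Measurable G :=
    Measurable.indicator ((hfm.comp (measurable_const_add w)).enorm.pow_const 2)
      Metric.isOpen_ball.measurableSet
  -- lower bound in polar coordinates
  have hlow : ENNReal.ofReal (R ^ 2 * Real.pi) * ‖f w‖ₑ ^ 2 ≤ ∫⁻ z, G z := by
    rw [← Complex.lintegral_comp_polarCoord_symm]
    have hpc : Measurable fun p : ℝ × ℝ => Complex.polarCoord.symm p := by
      simp only [Complex.polarCoord_symm_apply]
      fun_prop
    have hm : Measurable fun p : ℝ × ℝ =>
        ENNReal.ofReal p.1 • G (Complex.polarCoord.symm p) :=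
      measurable_fst.ennreal_ofReal.mul (hGm.comp hpc)
    rw [polarCoord_target, Measure.volume_eq_prod, ← Measure.prod_restrict,
      lintegral_prod _ hm.aemeasurable]
    have hin : ∀ r ∈ Ioo 0 R, ENNReal.ofReal r * (ENNReal.ofReal (2 * Real.pi) * ‖f w‖ₑ ^ 2) ≤
        ∫⁻ θ in Ioo (-Real.pi) Real.pi,
          ENNReal.ofReal (r, θ).1 • G (Complex.polarCoord.symm (r, θ)) := by
      intro r hr
      simp only [smul_eq_mul]
      rw [lintegral_const_mul' _ _ ENNReal.ofReal_ne_top]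
      gcongr
      refine (circle_le hf hr.1 (hr.2.trans hRw)).trans_eq (lintegral_congr fun θ => ?_)
      have hmem : Complex.polarCoord.symm (r, θ) ∈ Metric.ball (0 : ℂ) R := by
        rw [mem_ball_zero_iff, Complex.norm_polarCoord_symm, abs_of_pos hr.1]
        exact hr.2
      rw [hG, indicator_of_mem hmem, Complex.polarCoord_symm_apply]
    have hr : ∫⁻ r in Ioo 0 R, ENNReal.ofReal r = ENNReal.ofReal (R ^ 2 / 2) := by
      rw [← ofReal_integral_eq_lintegral_ofReal, ← integral_Ioc_eq_integral_Ioo,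
        ← intervalIntegral.integral_of_le hR.le, integral_id]
      · simp
      · exact (continuous_id.integrableOn_Icc).mono_set Ioo_subset_Icc_self
      · exact (ae_restrict_iff' measurableSet_Ioo).2 (Eventually.of_forall fun r hr => hr.1.le)
    calc ENNReal.ofReal (R ^ 2 * Real.pi) * ‖f w‖ₑ ^ 2
        = ENNReal.ofReal (R ^ 2 / 2) * (ENNReal.ofReal (2 * Real.pi) * ‖f w‖ₑ ^ 2) := by
          rw [← mul_assoc, ← ENNReal.ofReal_mul (by positivity)]
          congr 2
          ring
      _ = ∫⁻ r in Ioo 0 R, ENNReal.ofReal r * (ENNReal.ofReal (2 * Real.pi) * ‖f w‖ₑ ^ 2) := by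
          rw [lintegral_mul_const _ ENNReal.measurable_ofReal, hr]
      _ ≤ ∫⁻ r in Ioo 0 R, ∫⁻ θ in Ioo (-Real.pi) Real.pi,
          ENNReal.ofReal (r, θ).1 • G (Complex.polarCoord.symm (r, θ)) :=
          setLIntegral_mono' measurableSet_Ioo hin
      _ ≤ _ := lintegral_mono_set Ioo_subset_Ioi_self
  refine hlow.trans ?_
  -- upper bound in Cartesian coordinates
  rw [← (Complex.volume_preserving_equiv_real_prod.symm).lintegral_comp_emb
    Complex.measurableEquivRealProd.symm.measurableEmbedding, Measure.volume_eq_prod,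
    lintegral_prod (fun p : ℝ × ℝ => G (Complex.measurableEquivRealProd.symm p))
      (hGm.comp Complex.measurableEquivRealProd.symm.measurable).aemeasurable]
  have hx : ∀ x : ℝ, ∫⁻ y : ℝ, G (Complex.measurableEquivRealProd.symm (x, y)) ≤
      (Ioo (-R) R).indicator (fun _ => ENNReal.ofReal Real.pi * hardySq f) x := by
    intro x
    have hmk : ∀ y : ℝ, Complex.measurableEquivRealProd.symm (x, y) = x + y * Complex.I :=
      fun y => by rw [Complex.measurableEquivRealProd_symm_apply, Complex.mk_eq_add_mul_I]
    by_cases hxR : x ∈ Ioo (-R) R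
    · rw [indicator_of_mem hxR]
      have hp : 0 < (w + x).re := by
        rw [Complex.add_re, Complex.ofReal_re]; linarith [hxR.1]
      refine (lintegral_mono (g := fun y : ℝ => ‖f ((w + x) + y * Complex.I)‖ₑ ^ 2)
        fun y => ?_).trans ?_
      · rw [hmk, hG]
        refine (indicator_le_self _ _ _).trans_eq ?_
        rw [← add_assoc]
      · rw [sl_translate]
        exact sl_le hp
    · rw [indicator_of_notMem hxR]
      refine le_of_eq ?_
      rw [lintegral_eq_zero_of_ae_eq_zero]
      refine Eventually.of_forall fun y => ?_
      change G (Complex.measurableEquivRealProd.symm (x, y)) = 0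
      rw [hmk, hG]
      refine indicator_of_notMem (fun h => hxR ?_) _
      rw [mem_ball_zero_iff] at h
      have := (Complex.abs_re_le_norm _).trans_lt h
      simp only [Complex.add_re, Complex.ofReal_re, Complex.mul_re, Complex.I_re, mul_zero,
        Complex.ofReal_im, Complex.I_im, mul_one, sub_self, add_zero] at this
      exact abs_lt.1 this
  refine (lintegral_mono hx).trans_eq ?_
  rw [lintegral_indicator measurableSet_Ioo, setLIntegral_const, Real.volume_Ioo,
    mul_right_comm, ← ENNReal.ofReal_mul Real.pi_pos.le]
  congr 2
  ring

lemma hardySq_add_rpow_le {f g : ℂ → ℂ} (hf : MemHardy f) (hg : MemHardy g) :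
    hardySq (f + g) ^ (1 / 2 : ℝ) ≤ hardySq f ^ (1 / 2 : ℝ) + hardySq g ^ (1 / 2 : ℝ) := by
  have hsc : ∀ u : ℂ → ℂ, ∀ x : ℝ, 0 < x →
      (ENNReal.ofReal (1 / Real.pi) * sl u x) ^ (1 / 2 : ℝ) ≤ hardySq u ^ (1 / 2 : ℝ) := by
    intro u x hx
    refine ENNReal.rpow_le_rpow ?_ (by norm_num)
    exact le_iSup₂_of_le x hx le_rfl
  have hmain : hardySq (f + g) ≤
      (hardySq f ^ (1 / 2 : ℝ) + hardySq g ^ (1 / 2 : ℝ)) ^ (2 : ℝ) := by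
    refine iSup₂_le fun x hx => ?_
    have hfc : Continuous fun y : ℝ => f (x + y * Complex.I) :=
      cont_line hf.diff (w := (x : ℂ)) (by simpa using hx)
    have hgc : Continuous fun y : ℝ => g (x + y * Complex.I) :=
      cont_line hg.diff (w := (x : ℂ)) (by simpa using hx)
    change ENNReal.ofReal (1 / Real.pi) * sl (f + g) x ≤ _
    have h1 : sl (f + g) x ^ (1 / 2 : ℝ) ≤ sl f x ^ (1 / 2 : ℝ) + sl g x ^ (1 / 2 : ℝ) := by
      have h2 := ENNReal.lintegral_Lp_add_le (μ := volume) (p := 2)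
        hfc.enorm.aemeasurable hgc.enorm.aemeasurable (by norm_num)
      simp only [ENNReal.rpow_ofNat, Pi.add_apply] at h2
      refine le_trans (ENNReal.rpow_le_rpow (lintegral_mono fun y => ?_) (by norm_num)) h2
      gcongr
      exact enorm_add_le _ _
    have h3 : (ENNReal.ofReal (1 / Real.pi) * sl (f + g) x) ^ (1 / 2 : ℝ) ≤
        hardySq f ^ (1 / 2 : ℝ) + hardySq g ^ (1 / 2 : ℝ) := by
      refine le_trans ?_ (add_le_add (hsc f x hx) (hsc g x hx))
      simp only [ENNReal.mul_rpow_of_nonneg _ _ (show (0 : ℝ) ≤ 1 / 2 by norm_num)]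
      rw [← mul_add]
      gcongr
    calc ENNReal.ofReal (1 / Real.pi) * sl (f + g) x
        = ((ENNReal.ofReal (1 / Real.pi) * sl (f + g) x) ^ (1 / 2 : ℝ)) ^ (2 : ℝ) := by
          rw [← ENNReal.rpow_mul]; norm_num
      _ ≤ _ := ENNReal.rpow_le_rpow h3 (by norm_num)
  calc hardySq (f + g) ^ (1 / 2 : ℝ)
      ≤ ((hardySq f ^ (1 / 2 : ℝ) + hardySq g ^ (1 / 2 : ℝ)) ^ (2 : ℝ)) ^ (1 / 2 : ℝ) :=
        ENNReal.rpow_le_rpow hmain (by norm_num)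
    _ = _ := by rw [← ENNReal.rpow_mul]; norm_num

end HardyAux

/-- The Hardy space as a vector space of functions. -/
def hardySubmodule : Submodule ℂ (ℂ → ℂ) where
  carrier := {f | MemHardy f}
  add_mem' := HardyAux.memHardy_add
  zero_mem' := HardyAux.memHardy_zero
  smul_mem' c _ hf := HardyAux.memHardy_smul c hf

/-- The Hardy space `H²` of the right half-plane. -/
def HardyH2 : Type := hardySubmodule

namespace HardyH2

noncomputable instance : AddCommGroup HardyH2 := inferInstanceAs (AddCommGroup hardySubmodule)

noncomputable instance : Module ℂ HardyH2 := inferInstanceAs (Module ℂ hardySubmodule)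

/-- The function underlying an element of the Hardy space. -/
def toFun (f : HardyH2) : ℂ → ℂ := f.1

instance : CoeFun HardyH2 fun _ => ℂ → ℂ := ⟨toFun⟩

/-- An element of the Hardy space from a function. -/
def mk (f : ℂ → ℂ) (hf : MemHardy f) : HardyH2 := ⟨f, hf⟩

@[simp] lemma mk_apply (f : ℂ → ℂ) (hf : MemHardy f) (w : ℂ) : mk f hf w = f w := rfl

/-- The Hardy norm. -/
noncomputable instance : Norm HardyH2 := ⟨fun f => Real.sqrt (hardySq f).toReal⟩

lemma mem (f : HardyH2) : MemHardy f := f.2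

lemma ext {f g : HardyH2} (h : ∀ w ∈ rightHalfPlane, f w = g w) : f = g := by
  refine Subtype.ext (funext fun w => ?_)
  by_cases hw : w ∈ rightHalfPlane
  · exact h w hw
  · change f w = g w
    rw [f.mem.zero_of_notMem w hw, g.mem.zero_of_notMem w hw]

@[simp] lemma add_apply (f g : HardyH2) (w : ℂ) : (f + g) w = f w + g w := rfl

@[simp] lemma sub_apply (f g : HardyH2) (w : ℂ) : (f - g) w = f w - g w := rfl

@[simp] lemma smul_apply (c : ℂ) (f : HardyH2) (w : ℂ) : (c • f) w = c * f w := rfl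

lemma norm_def (f : HardyH2) : ‖f‖ = Real.sqrt (hardySq f).toReal := rfl

lemma norm_eq_rpow (f : HardyH2) : ‖f‖ = (hardySq f ^ (1 / 2 : ℝ)).toReal := by
  rw [norm_def, Real.sqrt_eq_rpow, ENNReal.toReal_rpow]

lemma norm_sq (f : HardyH2) : ‖f‖ ^ 2 = (hardySq f).toReal :=
  Real.sq_sqrt ENNReal.toReal_nonneg

lemma norm_apply_sq_le (f : HardyH2) {w : ℂ} {R : ℝ} (hR : 0 < R) (hRw : R < w.re) :
    ‖f w‖ ^ 2 ≤ 2 / R * ‖f‖ ^ 2 := by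
  have h := ENNReal.toReal_mono (ENNReal.mul_ne_top ENNReal.ofReal_ne_top f.mem.finite.ne)
    (HardyAux.point_bound f.mem hR hRw)
  have hpi := Real.pi_pos
  rw [ENNReal.toReal_mul, ENNReal.toReal_mul, ENNReal.toReal_ofReal (by positivity),
    ENNReal.toReal_ofReal (by positivity), ENNReal.toReal_pow, toReal_enorm, ← norm_sq] at h
  have h2 : R * Real.pi * (R * ‖f w‖ ^ 2) ≤ R * Real.pi * (2 * ‖f‖ ^ 2) := by linarith
  have h3 := le_of_mul_le_mul_left h2 (by positivity)
  rw [div_mul_eq_mul_div, le_div_iff₀ hR]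
  linarith

lemma core : NormedSpace.Core ℂ HardyH2 where
  norm_nonneg f := Real.sqrt_nonneg _
  norm_smul c f := by
    rw [norm_def, norm_def, show ((c • f : HardyH2) : ℂ → ℂ) = c • (f : ℂ → ℂ) from rfl,
      HardyAux.hardySq_smul, ENNReal.toReal_mul, Real.sqrt_mul ENNReal.toReal_nonneg,
      ENNReal.toReal_pow, toReal_enorm, Real.sqrt_sq (norm_nonneg c)]
  norm_triangle f g := by
    have hf := f.mem
    have hg := g.mem
    have t : ∀ u : HardyH2, hardySq u ^ (1 / 2 : ℝ) ≠ ⊤ := fun u =>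
      ENNReal.rpow_ne_top_of_nonneg (by norm_num) u.mem.finite.ne
    rw [norm_eq_rpow, norm_eq_rpow, norm_eq_rpow, ← ENNReal.toReal_add (t f) (t g)]
    exact ENNReal.toReal_mono (ENNReal.add_ne_top.2 ⟨t f, t g⟩)
      (HardyAux.hardySq_add_rpow_le hf hg)
  norm_eq_zero_iff f := by
    constructor
    · intro h
      refine ext fun w hw => ?_
      have hw : 0 < w.re := hw
      have h1 := norm_apply_sq_le f (w := w) (half_pos hw) (half_lt_self hw)
      rw [h] at h1
      have h2 : ‖f w‖ ^ 2 = 0 := le_antisymm (by simpa using h1) (by positivity)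
      change f w = 0
      simpa using h2
    · rintro rfl
      rw [norm_def, show ((0 : HardyH2) : ℂ → ℂ) = 0 from rfl]
      simp [hardySq]

noncomputable instance : NormedAddCommGroup HardyH2 := NormedAddCommGroup.ofCore core

noncomputable instance : NormedSpace ℂ HardyH2 := NormedSpace.ofCore core

/-- The inner product that induces the Hardy norm (given by polarization). -/
noncomputable instance : InnerProductSpace ℂ HardyH2 := InnerProductSpace.ofNorm ℂ fun f g : HardyH2 => by
  have h : (hardySq (f + g : HardyH2) + hardySq (f - g : HardyH2)).toReal =
      (2 * (hardySq f + hardySq g)).toReal :=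
    congrArg ENNReal.toReal (HardyAux.hardySq_parallelogram f.mem g.mem)
  have hf := f.mem.finite.ne
  have hg := g.mem.finite.ne
  have ha := (f + g).mem.finite.ne
  have hs := (f - g).mem.finite.ne
  rw [ENNReal.toReal_add ha hs, ENNReal.toReal_mul, ENNReal.toReal_add hf hg] at h
  rw [← sq, ← sq, ← sq, ← sq, norm_sq, norm_sq, norm_sq, norm_sq]
  simpa using h

lemma norm_apply_le (f : HardyH2) {w : ℂ} {R : ℝ} (hR : 0 < R) (hRw : R < w.re) :
    ‖f w‖ ≤ Real.sqrt (2 / R) * ‖f‖ := by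
  refine le_of_sq_le_sq ?_ (by positivity)
  rw [mul_pow, Real.sq_sqrt (by positivity)]
  exact norm_apply_sq_le f hR hRw

instance : CompleteSpace HardyH2 := by
  refine Metric.complete_of_cauchySeq_tendsto fun u hu => ?_
  have hdiff : ∀ R > 0, ∀ ε > 0, ∃ N, ∀ m ≥ N, ∀ n ≥ N, ∀ w : ℂ, R < w.re →
      ‖u m w - u n w‖ < ε := by
    intro R hR ε hε
    have hs : 0 < Real.sqrt (2 / R) := Real.sqrt_pos.2 (by positivity)
    obtain ⟨N, hN⟩ := Metric.cauchySeq_iff.1 hu (ε / Real.sqrt (2 / R)) (by positivity)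
    refine ⟨N, fun m hm n hn w hw => ?_⟩
    have h1 := norm_apply_le (u m - u n) hR hw
    have h2 := hN m hm n hn
    rw [dist_eq_norm, lt_div_iff₀ hs] at h2
    rw [sub_apply] at h1
    linarith
  have hlim : ∀ w : ℂ, ∃ l, Tendsto (fun n => u n w) atTop (𝓝 l) := by
    intro w
    by_cases hw : w ∈ rightHalfPlane
    · have hw : 0 < w.re := hw
      refine cauchySeq_tendsto_of_complete (Metric.cauchySeq_iff.2 fun ε hε => ?_)
      obtain ⟨N, hN⟩ := hdiff (w.re / 2) (half_pos hw) ε hε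
      refine ⟨N, fun m hm n hn => ?_⟩
      rw [dist_eq_norm]
      exact hN m hm n hn w (half_lt_self hw)
    · refine ⟨0, ?_⟩
      simp only [(u _).mem.zero_of_notMem w hw, tendsto_const_nhds]
  choose F hF using hlim
  have hFd : DifferentiableOn ℂ F rightHalfPlane := by
    refine TendstoLocallyUniformlyOn.differentiableOn (F := fun n => (u n : ℂ → ℂ)) (φ := atTop)
      ?_ (Eventually.of_forall fun n => (u n).mem.diff) HardyAux.isOpen_rhp
    rw [Metric.tendstoLocallyUniformlyOn_iff]
    intro ε hε w hw
    have hw : 0 < w.re := hw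
    refine ⟨{z | w.re / 2 < z.re}, mem_nhdsWithin_of_mem_nhds
      ((isOpen_lt continuous_const Complex.continuous_re).mem_nhds (half_lt_self hw)), ?_⟩
    obtain ⟨N, hN⟩ := hdiff (w.re / 2) (half_pos hw) (ε / 2) (half_pos hε)
    filter_upwards [eventually_ge_atTop N] with n hn z hz
    rw [dist_eq_norm]
    have : ‖F z - u n z‖ ≤ ε / 2 := by
      refine le_of_tendsto ((hF z).sub_const (u n z)).norm ?_
      filter_upwards [eventually_ge_atTop N] with m hm
      exact (hN m hm n hn z hz).le
    linarith
  have hF0 : ∀ w, w ∉ rightHalfPlane → F w = 0 := by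
    intro w hw
    refine tendsto_nhds_unique (hF w) ?_
    simp only [(u _).mem.zero_of_notMem w hw, tendsto_const_nhds]
  have hfat : ∀ ε > 0, ∃ N, ∀ n ≥ N,
      hardySq (F - (u n : ℂ → ℂ)) ≤ ENNReal.ofReal (ε ^ 2) := by
    intro ε hε
    obtain ⟨N, hN⟩ := Metric.cauchySeq_iff.1 hu ε hε
    refine ⟨N, fun n hn => iSup₂_le fun x hx => ?_⟩
    have hb : ∀ m ≥ N, ENNReal.ofReal (1 / Real.pi) *
        ∫⁻ y : ℝ, ‖u m (x + y * Complex.I) - u n (x + y * Complex.I)‖ₑ ^ 2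
          ≤ ENNReal.ofReal (ε ^ 2) := by
      intro m hm
      have h1 := hN m hm n hn
      rw [dist_eq_norm] at h1
      have h2 : (hardySq (u m - u n : HardyH2)).toReal ≤ ε ^ 2 := by
        rw [← norm_sq]
        gcongr
      refine le_trans ?_ ((ENNReal.le_ofReal_iff_toReal_le (u m - u n).mem.finite.ne
        (by positivity)).2 h2)
      exact le_iSup₂_of_le x hx le_rfl
    have hmeas : ∀ m, Measurable fun y : ℝ => ENNReal.ofReal (1 / Real.pi) *
        ‖u m (x + y * Complex.I) - u n (x + y * Complex.I)‖ₑ ^ 2 := by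
      intro m
      have h1 := (HardyAux.measurable_memHardy (u m - u n).mem)
      have h2 : Measurable fun y : ℝ => (x + y * Complex.I : ℂ) := by fun_prop
      exact ((h1.comp h2).enorm.pow_const 2).const_mul _
    calc ENNReal.ofReal (1 / Real.pi) *
          ∫⁻ y : ℝ, ‖(F - (u n : ℂ → ℂ)) (x + y * Complex.I)‖ₑ ^ 2
        = ∫⁻ y : ℝ, liminf (fun m => ENNReal.ofReal (1 / Real.pi) *
          ‖u m (x + y * Complex.I) - u n (x + y * Complex.I)‖ₑ ^ 2) atTop := by
          rw [← lintegral_const_mul' _ _ ENNReal.ofReal_ne_top]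
          refine lintegral_congr fun y => ?_
          refine (Tendsto.liminf_eq ?_).symm
          refine ENNReal.Tendsto.const_mul ?_ (Or.inr ENNReal.ofReal_ne_top)
          refine ENNReal.Tendsto.pow ?_
          exact ((hF _).sub_const _).enorm
      _ ≤ liminf (fun m => ∫⁻ y : ℝ, ENNReal.ofReal (1 / Real.pi) *
          ‖u m (x + y * Complex.I) - u n (x + y * Complex.I)‖ₑ ^ 2) atTop :=
          lintegral_liminf_le hmeas
      _ ≤ ENNReal.ofReal (ε ^ 2) := by
          refine liminf_le_of_frequently_le' (Eventually.frequently ?_)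
          filter_upwards [eventually_ge_atTop N] with m hm
          rw [lintegral_const_mul' _ _ ENNReal.ofReal_ne_top]
          exact hb m hm
  have hsub : ∀ n, hardySq (F - (u n : ℂ → ℂ)) < ⊤ → MemHardy (F - (u n : ℂ → ℂ)) := fun n hn =>
    { diff := hFd.sub (u n).mem.diff
      zero_of_notMem := fun w hw => by simp [hF0 w hw, (u n).mem.zero_of_notMem w hw]
      finite := hn }
  have hFm : MemHardy F := by
    obtain ⟨N, hN⟩ := hfat 1 one_pos
    have h1 := hsub N ((hN N le_rfl).trans_lt ENNReal.ofReal_lt_top)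
    have h2 := HardyAux.memHardy_add h1 (u N).mem
    simpa using h2
  refine ⟨mk F hFm, Metric.tendsto_atTop.2 fun ε hε => ?_⟩
  obtain ⟨N, hN⟩ := hfat (ε / 2) (half_pos hε)
  refine ⟨N, fun n hn => ?_⟩
  rw [dist_comm, dist_eq_norm]
  refine lt_of_le_of_lt ?_ (half_lt_self hε)
  refine le_of_sq_le_sq ?_ (half_pos hε).le
  rw [norm_sq]
  change (hardySq (F - (u n : ℂ → ℂ))).toReal ≤ _
  exact ENNReal.toReal_le_of_le_ofReal (by positivity) (hN n hn)

end HardyH2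

namespace HardyAux

lemma affine_re (a : ℝ) (b w : ℂ) : (a * w + b).re = a * w.re + b.re := by simp

lemma affine_mem {a : ℝ} (ha : 0 < a) {b : ℂ} (hb : 0 ≤ b.re) {w : ℂ} (hw : w ∈ rightHalfPlane) :
    a * w + b ∈ rightHalfPlane := by
  have hw : 0 < w.re := hw
  change 0 < (a * w + b).re
  rw [affine_re]
  positivity

/-- The composite `f ∘ φ` on the right half-plane, extended by zero. -/
noncomputable def compFun (φ : ℂ → ℂ) (f : ℂ → ℂ) : ℂ → ℂ :=
  rightHalfPlane.indicator (f ∘ φ)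

lemma sl_comp_affine {a : ℝ} (ha : 0 < a) {b : ℂ} {f : ℂ → ℂ} {x : ℝ} (hx : 0 < x) :
    sl (compFun (fun w => a * w + b) f) x = ENNReal.ofReal a⁻¹ * sl f (a * x + b.re) := by
  have h1 : sl (compFun (fun w => a * w + b) f) x =
      ∫⁻ y : ℝ, ‖f ((a * x + b) + (a * y : ℝ) * Complex.I)‖ₑ ^ 2 := by
    refine lintegral_congr fun y => ?_
    rw [compFun, indicator_of_mem (mem_rhp hx y), Function.comp_apply]
    congr 3
    push_cast
    ring
  rw [h1]
  have h2 := (Homeomorph.mulLeft₀ a ha.ne').measurableEmbedding.lintegral_map (μ := volume)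
    (fun y : ℝ => ‖f ((a * x + b) + y * Complex.I)‖ₑ ^ 2)
  simp only [Homeomorph.coe_mulLeft₀] at h2
  rw [← h2, Real.map_volume_mul_left ha.ne', lintegral_smul_measure, sl_translate,
    abs_of_pos (inv_pos.2 ha), smul_eq_mul]
  simp

lemma hardySq_comp_affine_le {a : ℝ} (ha : 0 < a) {b : ℂ} (hb : 0 ≤ b.re) (f : ℂ → ℂ) :
    hardySq (compFun (fun w => a * w + b) f) ≤ ENNReal.ofReal a⁻¹ * hardySq f := by
  refine iSup₂_le fun x hx => ?_
  change ENNReal.ofReal (1 / Real.pi) * sl (compFun (fun w => a * w + b) f) x ≤ _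
  rw [sl_comp_affine ha hx, mul_left_comm]
  gcongr
  have : 0 < a * x + b.re := by positivity
  exact le_iSup₂_of_le (a * x + b.re) this le_rfl

lemma memHardy_comp_affine {a : ℝ} (ha : 0 < a) {b : ℂ} (hb : 0 ≤ b.re) {f : ℂ → ℂ}
    (hf : MemHardy f) : MemHardy (compFun (fun w => a * w + b) f) where
  diff := by
    have h : DifferentiableOn ℂ (f ∘ fun w => a * w + b) rightHalfPlane :=
      hf.diff.comp (by fun_prop) fun w hw => affine_mem ha hb hw
    exact h.congr fun w hw => indicator_of_mem hw _
  zero_of_notMem w hw := indicator_of_notMem hw _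
  finite := (hardySq_comp_affine_le ha hb f).trans_lt
    (ENNReal.mul_lt_top ENNReal.ofReal_lt_top hf.finite)

end HardyAux

namespace HardyH2

/-- The composition operator `C_φ f = f ∘ φ` on the Hardy space, for `φ(w) = a w + b` with
`a > 0` and `Re b ≥ 0`. -/
noncomputable def compAffine (a : ℝ) (b : ℂ) (ha : 0 < a) (hb : 0 ≤ b.re) :
    HardyH2 →L[ℂ] HardyH2 :=
  LinearMap.mkContinuous
    { toFun := fun f => mk (HardyAux.compFun (fun w => a * w + b) f)
        (HardyAux.memHardy_comp_affine ha hb f.mem)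
      map_add' := fun f g => ext fun w hw => by
        simp [HardyAux.compFun, indicator_of_mem hw]
      map_smul' := fun c f => ext fun w hw => by
        simp [HardyAux.compFun, indicator_of_mem hw] }
    (Real.sqrt a⁻¹) fun f => by
      have h := ENNReal.toReal_mono (ENNReal.mul_ne_top ENNReal.ofReal_ne_top f.mem.finite.ne)
        (HardyAux.hardySq_comp_affine_le ha hb f)
      rw [ENNReal.toReal_mul, ENNReal.toReal_ofReal (inv_nonneg.2 ha.le)] at h
      rw [norm_def f, ← Real.sqrt_mul (inv_nonneg.2 ha.le)]
      exact Real.sqrt_le_sqrt h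

lemma compAffine_apply {a : ℝ} {b : ℂ} (ha : 0 < a) (hb : 0 ≤ b.re) (f : HardyH2) {w : ℂ}
    (hw : w ∈ rightHalfPlane) : compAffine a b ha hb f w = f (a * w + b) :=
  indicator_of_mem hw _

/-- The composition operator `C_τ`, for `τ(w) = w + c` with `Re c = 0`, as an invertible operator;
its inverse is the composition operator of `w ↦ w - c`. -/
noncomputable def compTranslation (c : ℂ) (hc : c.re = 0) : HardyH2 ≃L[ℂ] HardyH2 :=
  ContinuousLinearEquiv.equivOfInverse
    (compAffine 1 c one_pos hc.ge) (compAffine 1 (-c) one_pos (by simp [hc]))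
    (fun f => ext fun w hw => by
      rw [compAffine_apply _ _ _ hw, compAffine_apply _ _ _
        (HardyAux.affine_mem one_pos (by simp [hc]) hw)]
      simp)
    (fun f => ext fun w hw => by
      rw [compAffine_apply _ _ _ hw, compAffine_apply _ _ _
        (HardyAux.affine_mem one_pos hc.ge hw)]
      simp)

lemma compTranslation_apply {c : ℂ} (hc : c.re = 0) (f : HardyH2) {w : ℂ}
    (hw : w ∈ rightHalfPlane) : compTranslation c hc f w = f (w + c) := by
  change compAffine 1 c one_pos hc.ge f w = _
  rw [compAffine_apply _ _ _ hw]
  simp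

end HardyH2

/-- A conjugation on a complex inner product space: a conjugate-linear involution `C` with
`⟨C x, C y⟩ = ⟨y, x⟩`. -/
structure IsConjugation {H : Type*} [NormedAddCommGroup H] [InnerProductSpace ℂ H]
    (C : H → H) : Prop where
  map_add : ∀ x y, C (x + y) = C x + C y
  map_smul : ∀ (c : ℂ) (x : H), C (c • x) = conj c • C x
  involutive : ∀ x, C (C x) = x
  inner_map : ∀ x y, inner ℂ (C x) (C y) = inner ℂ y x

/-- A bounded operator `T` is `C`-symmetric if `C` is a conjugation and `C T* C = T`. -/
def IsSymmetricFor {H : Type*} [NormedAddCommGroup H] [InnerProductSpace ℂ H] [CompleteSpace H]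
    (C : H → H) (T : H →L[ℂ] H) : Prop :=
  IsConjugation C ∧ ∀ x, C (ContinuousLinearMap.adjoint T (C x)) = T x

lemma pos_of_hyperbolic {a : ℝ} (ha : a ∈ Ioo (0 : ℝ) 1 ∪ Ioi 1) : 0 < a :=
  ha.elim (fun h => h.1) fun h => one_pos.trans h

lemma re_div_one_sub (a : ℝ) {b : ℂ} (hb : b.re = 0) : (b / (1 - a)).re = 0 := by
  rw [← Complex.ofReal_one, ← Complex.ofReal_sub, Complex.div_ofReal_re, hb, zero_div]

/- Since `b / (1 - a)` is the fixed point of `φ`, `C_φ = C_τ⁻¹ C_δ C_τ` with `δ(w) = a w`; as `C_τ`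
is unitary, it suffices that `W₀` is a conjugation and that `C_δ` is `W₀`-symmetric. The latter is
read off from `C_δ* = a⁻¹ C_δ⁻¹`, which holds because `C_δ` scales norms by `a ^ (-1 / 2)`.

That `W₀` is antiunitary comes from a symmetry of the reproducing kernel `K`. The formula for `C_δ*`
gives `K_w(z p) = z⁻¹ K_{w / conj z}(p)` for `z = a > 0`. Both sides are holomorphic in `z`, so this
persists for complex `z`, and `z = 1 / (v conj u)` shows that the vectors `u⁻¹ K_{1 / conj u}` have
the conjugate of the Gram matrix of the vectors `K_u`, whose span is dense. -/

section HilbertSpace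

variable {H H' : Type*} [NormedAddCommGroup H] [InnerProductSpace ℂ H] [NormedAddCommGroup H']
  [InnerProductSpace ℂ H']

theorem IsConjugation.symm_comp_comp {C : H' → H'} (hC : IsConjugation C) (U : H ≃ₗᵢ[ℂ] H') :
    IsConjugation (U.symm ∘ C ∘ U) where
  map_add x y := by simp [hC.map_add]
  map_smul c x := by simp [hC.map_smul]
  involutive x := by simp [hC.involutive]
  inner_map x y := by
    simp only [Function.comp_apply, LinearIsometryEquiv.inner_map_map, hC.inner_map]

theorem IsSymmetricFor.symm_comp_comp [CompleteSpace H] [CompleteSpace H'] {C : H' → H'}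
    {T : H' →L[ℂ] H'} (h : IsSymmetricFor C T) (U : H ≃ₗᵢ[ℂ] H') :
    IsSymmetricFor (U.symm ∘ C ∘ U)
      ((U.symm : H' →L[ℂ] H) ∘L T ∘L (U : H →L[ℂ] H')) := by
  refine ⟨h.1.symm_comp_comp U, fun x => ?_⟩
  rw [ContinuousLinearMap.adjoint_comp, ContinuousLinearMap.adjoint_comp, U.adjoint_eq_symm,
    U.symm.adjoint_eq_symm, U.symm_symm]
  simp [h.2]

theorem exists_conjLinear_isometry_of_gram_eq [CompleteSpace H'] {X : Type*} {k : X → H}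
    {l : X → H'} (hk : (Submodule.span ℂ (range k)).topologicalClosure = ⊤)
    (hkl : ∀ x y, inner ℂ (l x) (l y) = inner ℂ (k y) (k x)) :
    ∃ C : H →SL[starRingEnd ℂ] H',
      (∀ x, C (k x) = l x) ∧ ∀ f g, inner ℂ (C f) (C g) = inner ℂ g f := by
  let E : (X →₀ ℂ) →ₗ[ℂ] H := Finsupp.linearCombination ℂ k
  let L : (X →₀ ℂ) →ₛₗ[starRingEnd ℂ] H' :=
    { toFun := fun c => c.sum fun x a => conj a • l x
      map_add' := fun c d => Finsupp.sum_add_index' (by simp) (by simp [add_smul])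
      map_smul' := fun a c => by
        rw [Finsupp.sum_smul_index (by simp), Finsupp.smul_sum]
        simp only [map_mul, mul_smul] }
  have inner_L (c d : X →₀ ℂ) : inner ℂ (L c) (L d) = inner ℂ (E d) (E c) := by
    simp only [E, L, LinearMap.coe_mk, AddHom.coe_mk, Finsupp.linearCombination_apply,
      Finsupp.sum_inner, Finsupp.inner_sum, inner_smul_left, inner_smul_right, hkl,
      Complex.conj_conj, Finsupp.mul_sum]
    rw [Finsupp.sum_comm]
    simp only [mul_left_comm]
  have norm_L (c : X →₀ ℂ) : ‖L c‖ = ‖E c‖ := by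
    rw [norm_eq_sqrt_re_inner (𝕜 := ℂ), inner_L, ← norm_eq_sqrt_re_inner]
  have dense_E : DenseRange E := by
    rw [← Submodule.dense_iff_topologicalClosure_eq_top, ← Finsupp.range_linearCombination] at hk
    exact hk
  have hC := LinearMap.extendOfNorm_eq dense_E ⟨1, fun c => by rw [norm_L, one_mul]⟩
  refine ⟨L.extendOfNorm E, fun x => ?_, fun f g => ?_⟩
  · simpa [E, L] using hC (Finsupp.single x 1)
  · refine dense_E.induction_on₂ (isClosed_eq (by fun_prop) (by fun_prop)) (fun c d => ?_) f g
    rw [hC, hC, inner_L]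

theorem adjoint_eq_smul_of_norm_sq_eq [CompleteSpace H] [CompleteSpace H'] {T : H →L[ℂ] H'}
    {S : H' →L[ℂ] H} {c : ℝ} (hT : ∀ x, ‖T x‖ ^ 2 = c * ‖x‖ ^ 2) (hTS : ∀ y, T (S y) = y) :
    ContinuousLinearMap.adjoint T = (c : ℂ) • S := by
  have adjoint_apply_apply (x : H) : ContinuousLinearMap.adjoint T (T x) = (c : ℂ) • x := by
    have : ((ContinuousLinearMap.adjoint T ∘L T : H →L[ℂ] H) : H →ₗ[ℂ] H) =
        (c : ℂ) • LinearMap.id := by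
      refine (ext_inner_map _ _).1 fun y => ?_
      change inner ℂ (ContinuousLinearMap.adjoint T (T y)) y = inner ℂ ((c : ℂ) • y) y
      rw [ContinuousLinearMap.adjoint_inner_left, inner_smul_left, Complex.conj_ofReal,
        inner_self_eq_norm_sq_to_K, inner_self_eq_norm_sq_to_K]
      simpa using congrArg Complex.ofReal (hT y)
    exact DFunLike.congr_fun this x
  ext1 y
  rw [← hTS y, adjoint_apply_apply, hTS]
  rfl

end HilbertSpace

theorem eqOn_of_eventually_ofReal_eq {f g : ℂ → ℂ} {S : Set ℂ} (hS : IsOpen S)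
    (hconn : IsPreconnected S) (hf : DifferentiableOn ℂ f S) (hg : DifferentiableOn ℂ g S) {x : ℝ}
    (hx : (x : ℂ) ∈ S) (hfg : ∀ᶠ r : ℝ in 𝓝 x, f r = g r) : EqOn f g S := by
  have hreal : Tendsto ((↑) : ℝ → ℂ) (𝓝[≠] x) (𝓝[≠] (x : ℂ)) :=
    Complex.continuous_ofReal.continuousWithinAt.tendsto_nhdsWithin fun _ _ => by simp_all
  exact (hf.analyticOnNhd hS).eqOn_of_preconnected_of_frequently_eq (hg.analyticOnNhd hS) hconn hx
    (hreal.frequently (hfg.filter_mono nhdsWithin_le_nhds).frequently)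

theorem ne_zero_of_mem_rhp {w : ℂ} (hw : w ∈ rightHalfPlane) : w ≠ 0 := by
  rintro rfl
  simp [rightHalfPlane] at hw

theorem div_conj_mem_rhp_iff {w z : ℂ} : w / conj z ∈ rightHalfPlane ↔ z * w ∈ rightHalfPlane := by
  rcases eq_or_ne z 0 with rfl | hz
  · simp
  have hz' : conj z ≠ 0 := by simpa
  have hdiv : w / conj z = z * w / (Complex.normSq z : ℝ) := by
    rw [← Complex.mul_conj]
    field_simp
  change 0 < (w / conj z).re ↔ 0 < (z * w).re
  rw [hdiv, Complex.div_ofReal_re, div_pos_iff_of_pos_right (Complex.normSq_pos.2 hz)]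

theorem one_div_conj_mem_rhp {w : ℂ} (hw : w ∈ rightHalfPlane) : 1 / conj w ∈ rightHalfPlane :=
  div_conj_mem_rhp_iff.2 (by rwa [mul_one])

theorem one_div_conj_one_div_conj (w : ℂ) : 1 / conj (1 / conj w) = w := by simp

namespace HardyH2

theorem exists_norm_apply_le (u : ℂ) : ∃ C, ∀ f : HardyH2, ‖f u‖ ≤ C * ‖f‖ := by
  by_cases hu : u ∈ rightHalfPlane
  · have hu : 0 < u.re := hu
    exact ⟨_, fun f => norm_apply_le f (half_pos hu) (half_lt_self hu)⟩
  · exact ⟨0, fun f => by simp [f.mem.zero_of_notMem u hu]⟩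

/-- The evaluation functional `f ↦ f u`. It is zero for `u` outside the right half-plane, where
all functions in `HardyH2` vanish by convention. -/
noncomputable def evalCLM (u : ℂ) : HardyH2 →L[ℂ] ℂ :=
  LinearMap.mkContinuousOfExistsBound
    { toFun := fun f => f u, map_add' := fun _ _ => rfl, map_smul' := fun _ _ => rfl }
    (exists_norm_apply_le u)

/-- The reproducing kernel at `u`: the vector representing the evaluation functional at `u`. -/
noncomputable def kernel (u : ℂ) : HardyH2 :=
  (InnerProductSpace.toDual ℂ HardyH2).symm (evalCLM u)

theorem inner_kernel (u : ℂ) (f : HardyH2) : inner ℂ (kernel u) f = f u :=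
  InnerProductSpace.toDual_symm_apply

theorem conj_kernel (u v : ℂ) : conj (kernel u v) = kernel v u := by
  rw [← inner_kernel v, inner_conj_symm, inner_kernel]

theorem topologicalClosure_span_kernel :
    (Submodule.span ℂ (range fun u : rightHalfPlane => kernel u)).topologicalClosure = ⊤ := by
  rw [Submodule.topologicalClosure_eq_top_iff, Submodule.eq_bot_iff]
  refine fun f hf => ext fun w hw => ?_
  rw [← inner_kernel w f]
  exact Submodule.inner_right_of_mem_orthogonal
    (Submodule.subset_span (mem_range_self (⟨w, hw⟩ : rightHalfPlane))) hf

theorem hardySq_compAffine {a : ℝ} {b : ℂ} (ha : 0 < a) (hb : b.re = 0) (f : HardyH2) :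
    hardySq (compAffine a b ha hb.ge f) = ENNReal.ofReal a⁻¹ * hardySq f := by
  refine le_antisymm (HardyAux.hardySq_comp_affine_le ha hb.ge f) ?_
  rw [HardyAux.hardySq_eq f, mul_left_comm, ENNReal.mul_iSup, HardyAux.hardySq_eq]
  refine mul_le_mul' le_rfl (iSup_le fun x => ?_)
  have hx : 0 < a⁻¹ * x.1 := mul_pos (inv_pos.2 ha) x.2
  have hsl := HardyAux.sl_comp_affine ha (b := b) (f := f) hx
  rw [hb, mul_inv_cancel_left₀ ha.ne', add_zero] at hsl
  rw [← hsl]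
  exact le_iSup (fun y : Ioi (0 : ℝ) => HardyAux.sl (compAffine a b ha hb.ge f) y) ⟨_, hx⟩

theorem norm_compAffine_sq {a : ℝ} {b : ℂ} (ha : 0 < a) (hb : b.re = 0) (f : HardyH2) :
    ‖compAffine a b ha hb.ge f‖ ^ 2 = a⁻¹ * ‖f‖ ^ 2 := by
  rw [norm_sq, norm_sq, hardySq_compAffine ha hb, ENNReal.toReal_mul,
    ENNReal.toReal_ofReal (inv_nonneg.2 ha.le)]

theorem adjoint_compAffine_apply {a : ℝ} {b : ℂ} (ha : 0 < a) (hb : b.re = 0) (f : HardyH2)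
    {w : ℂ} (hw : w ∈ rightHalfPlane) :
    ContinuousLinearMap.adjoint (compAffine a b ha hb.ge) f w = (a : ℂ)⁻¹ * f ((w - b) / a) := by
  have ha0 : (a : ℂ) ≠ 0 := by exact_mod_cast ha.ne'
  have hba : 0 ≤ (-(b / a)).re := by simp [hb]
  have right_inverse (g : HardyH2) :
      compAffine a b ha hb.ge (compAffine a⁻¹ (-(b / a)) (inv_pos.2 ha) hba g) = g := by
    refine ext fun z hz => ?_
    rw [compAffine_apply _ _ _ hz, compAffine_apply _ _ _ (HardyAux.affine_mem ha hb.ge hz)]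
    congr 1
    push_cast
    field_simp
    ring
  rw [adjoint_eq_smul_of_norm_sq_eq (norm_compAffine_sq ha hb) right_inverse]
  change ((a⁻¹ : ℝ) : ℂ) * compAffine a⁻¹ _ _ _ f w = _
  rw [compAffine_apply _ _ _ hw, Complex.ofReal_inv]
  congr 2
  field_simp
  ring

theorem adjoint_compAffine_kernel {a : ℝ} {b : ℂ} (ha : 0 < a) (hb : 0 ≤ b.re) {w : ℂ}
    (hw : w ∈ rightHalfPlane) :
    ContinuousLinearMap.adjoint (compAffine a b ha hb) (kernel w) = kernel (a * w + b) := by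
  refine ext_inner_right ℂ fun f => ?_
  rw [ContinuousLinearMap.adjoint_inner_left, inner_kernel, inner_kernel, compAffine_apply _ _ _ hw]

/-- The composition operator `C_τ` of a vertical translation `τ(w) = w + c`, as a unitary. -/
noncomputable def compTranslationIsometry (c : ℂ) (hc : c.re = 0) : HardyH2 ≃ₗᵢ[ℂ] HardyH2 where
  toLinearEquiv := (compTranslation c hc).toLinearEquiv
  norm_map' f := by
    have h : ‖compTranslation c hc f‖ ^ 2 = 1⁻¹ * ‖f‖ ^ 2 := norm_compAffine_sq one_pos hc f
    rwa [inv_one, one_mul, pow_left_inj₀ (norm_nonneg _) (norm_nonneg _) two_ne_zero] at h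

theorem compTranslation_symm_apply {c : ℂ} (hc : c.re = 0) (f : HardyH2) {w : ℂ}
    (hw : w ∈ rightHalfPlane) : (compTranslation c hc).symm f w = f (w - c) := by
  change compAffine 1 (-c) one_pos (by simp [hc]) f w = _
  rw [compAffine_apply _ _ _ hw, Complex.ofReal_one, one_mul, sub_eq_add_neg]

theorem compAffine_eq_symm_comp_dilation_comp {a : ℝ} {b c : ℂ} (ha : 0 < a)
    (hb : 0 ≤ b.re) (hc : c.re = 0) (hbc : a * c + b = c) :
    compAffine a b ha hb = (compTranslation c hc).symm.toContinuousLinearMap ∘L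
      compAffine a 0 ha le_rfl ∘L (compTranslation c hc).toContinuousLinearMap := by
  refine ContinuousLinearMap.ext fun f => ext fun w hw => ?_
  have hwc : w - c ∈ rightHalfPlane := by
    simpa [rightHalfPlane, hc] using hw
  change _ = (compTranslation c hc).symm (compAffine a 0 ha le_rfl (compTranslation c hc f)) w
  rw [compAffine_apply _ _ _ hw, compTranslation_symm_apply _ _ hw, compAffine_apply _ _ _ hwc,
    compTranslation_apply _ _ (HardyAux.affine_mem ha le_rfl hwc)]
  congr 1
  linear_combination hbc

theorem kernel_affine {a : ℝ} {b : ℂ} (ha : 0 < a) (hb : b.re = 0) {u v : ℂ}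
    (hu : u ∈ rightHalfPlane) (hv : v ∈ rightHalfPlane) :
    kernel (a * v + b) (a * u + b) = (a : ℂ)⁻¹ * kernel v u := by
  have ha0 : (a : ℂ) ≠ 0 := by exact_mod_cast ha.ne'
  rw [← adjoint_compAffine_kernel ha hb.ge hv,
    adjoint_compAffine_apply ha hb _ (HardyAux.affine_mem ha hb.ge hu), add_sub_cancel_right,
    mul_div_cancel_left₀ _ ha0]

theorem differentiableAt_apply (f : HardyH2) {w : ℂ} (hw : w ∈ rightHalfPlane) :
    DifferentiableAt ℂ f w :=
  f.mem.diff.differentiableAt (HardyAux.isOpen_rhp.mem_nhds hw)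

theorem differentiableAt_kernel_conj {u z : ℂ} (hz : conj z ∈ rightHalfPlane) :
    DifferentiableAt ℂ (fun ζ => kernel (conj ζ) u) z := by
  simpa only [conj_kernel, Function.comp_def] using
    differentiableAt_conj_conj_iff.2 (differentiableAt_apply (kernel u) hz)

theorem kernel_mul {p w z : ℂ} (hp : p ∈ rightHalfPlane) (hw : w ∈ rightHalfPlane)
    (hzp : z * p ∈ rightHalfPlane) (hzw : z * w ∈ rightHalfPlane) :
    kernel w (z * p) = z⁻¹ * kernel (w / conj z) p := by
  let S : Set ℂ := {z | z * p ∈ rightHalfPlane ∧ z * w ∈ rightHalfPlane}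
  have hS : IsOpen S :=
    (HardyAux.isOpen_rhp.preimage (continuous_mul_const p)).inter
      (HardyAux.isOpen_rhp.preimage (continuous_mul_const w))
  have hconn : IsPreconnected S := by
    have hconv (q : ℂ) : Convex ℝ {z : ℂ | z * q ∈ rightHalfPlane} :=
      (convex_halfSpace_re_gt 0).linear_preimage (LinearMap.mulRight ℝ q)
    exact ((hconv p).inter (hconv w)).isPreconnected
  have hleft : DifferentiableOn ℂ (fun z => kernel w (z * p)) S := fun z hz =>
    ((differentiableAt_apply _ hz.1).comp z (by fun_prop)).differentiableWithinAt
  have hright : DifferentiableOn ℂ (fun z => z⁻¹ * kernel (w / conj z) p) S := by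
    intro z hz
    have hz0 : z ≠ 0 := left_ne_zero_of_mul (ne_zero_of_mem_rhp hz.1)
    have hkernel := (differentiableAt_kernel_conj (u := p) (z := conj w / z)
      (by simpa using div_conj_mem_rhp_iff.2 hz.2)).comp z (f := fun ζ => conj w / ζ)
      (by fun_prop (disch := assumption))
    simp only [Function.comp_def, map_div₀, Complex.conj_conj] at hkernel
    exact ((differentiableAt_inv hz0).mul hkernel).differentiableWithinAt
  have hreal : ∀ᶠ r : ℝ in 𝓝 1, kernel w (r * p) = (r : ℂ)⁻¹ * kernel (w / conj (r : ℂ)) p := by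
    filter_upwards [lt_mem_nhds one_pos] with r hr
    have hr0 : (r : ℂ) ≠ 0 := by exact_mod_cast hr.ne'
    have hwr : w / conj (r : ℂ) ∈ rightHalfPlane :=
      div_conj_mem_rhp_iff.2 (by simpa using HardyAux.affine_mem hr Complex.zero_re.ge hw)
    simpa [mul_div_cancel₀ _ hr0] using kernel_affine hr Complex.zero_re hp hwr
  exact eqOn_of_eventually_ofReal_eq hS hconn hleft hright (by simpa [S] using ⟨hp, hw⟩) hreal
    ⟨hzp, hzw⟩

theorem kernel_one_div_conj {u v : ℂ} (hu : u ∈ rightHalfPlane) (hv : v ∈ rightHalfPlane) :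
    kernel (1 / conj v) (1 / conj u) = conj u * v * kernel u v := by
  have hu0 := ne_zero_of_mem_rhp hu
  have hv0 := ne_zero_of_mem_rhp hv
  have hu0' : conj u ≠ 0 := by simpa
  have hv0' : conj v ≠ 0 := by simpa
  let z := 1 / (conj u * v)
  have hzv : z * v = 1 / conj u := by
    simp only [z]
    field_simp
  have hdiv : 1 / conj v / conj z = u := by
    simp only [z, map_div₀, map_one, map_mul, Complex.conj_conj]
    field_simp
  have h := kernel_mul hv (one_div_conj_mem_rhp hv) (hzv ▸ one_div_conj_mem_rhp hu)
    (div_conj_mem_rhp_iff.1 (hdiv.symm ▸ hu))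
  rw [← hzv, h, hdiv]
  simp only [z, one_div, inv_inv]

theorem exists_inversion : ∃ C : HardyH2 →SL[starRingEnd ℂ] HardyH2,
    (∀ u ∈ rightHalfPlane, C (kernel u) = (1 / u) • kernel (1 / conj u)) ∧
      ∀ f g, inner ℂ (C f) (C g) = inner ℂ g f := by
  have gram_eq (u v : rightHalfPlane) :
      inner ℂ ((1 / u : ℂ) • kernel (1 / conj (u : ℂ))) ((1 / v : ℂ) • kernel (1 / conj (v : ℂ))) =
        inner ℂ (kernel v) (kernel u) := by
    have hu0 : conj (u : ℂ) ≠ 0 := by simpa using ne_zero_of_mem_rhp u.2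
    have hv0 := ne_zero_of_mem_rhp v.2
    rw [inner_smul_left, inner_smul_right, inner_kernel, inner_kernel,
      kernel_one_div_conj u.2 v.2, map_div₀, map_one]
    field_simp
  obtain ⟨C, hC, hinner⟩ :=
    exists_conjLinear_isometry_of_gram_eq topologicalClosure_span_kernel gram_eq
  exact ⟨C, fun u hu => hC ⟨u, hu⟩, hinner⟩

/-- The operator `W₀` of the paper, obtained as the antiunitary that maps the kernel at `u` to
`u⁻¹` times the kernel at `1 / conj u`; see `inversion_apply` for the defining formula. -/
noncomputable def inversion : HardyH2 →SL[starRingEnd ℂ] HardyH2 :=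
  exists_inversion.choose

theorem inversion_kernel {u : ℂ} (hu : u ∈ rightHalfPlane) :
    inversion (kernel u) = (1 / u) • kernel (1 / conj u) :=
  exists_inversion.choose_spec.1 u hu

theorem inner_inversion (f g : HardyH2) : inner ℂ (inversion f) (inversion g) = inner ℂ g f :=
  exists_inversion.choose_spec.2 f g

theorem inversion_apply (f : HardyH2) {w : ℂ} (hw : w ∈ rightHalfPlane) :
    inversion f w = 1 / w * conj (f (1 / conj w)) := by
  have hw0 := ne_zero_of_mem_rhp hw
  have hkernel : inversion (kernel (1 / conj w)) = conj w • kernel w := by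
    rw [inversion_kernel (one_div_conj_mem_rhp hw), one_div_one_div, one_div_conj_one_div_conj]
  have h : w * inversion f w = conj (f (1 / conj w)) :=
    calc w * inversion f w = inner ℂ (inversion (kernel (1 / conj w))) (inversion f) := by
          rw [hkernel, inner_smul_left, inner_kernel, Complex.conj_conj]
      _ = inner ℂ f (kernel (1 / conj w)) := inner_inversion _ _
      _ = conj (f (1 / conj w)) := by rw [← inner_conj_symm, inner_kernel]
  rw [← h]
  field_simp

theorem isConjugation_inversion : IsConjugation inversion where
  map_add := map_add inversion
  map_smul := map_smulₛₗ inversion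
  involutive f := ext fun w hw => by
    have hw0 := ne_zero_of_mem_rhp hw
    rw [inversion_apply _ hw, inversion_apply _ (one_div_conj_mem_rhp hw),
      one_div_conj_one_div_conj]
    simp [hw0]
  inner_map := inner_inversion

theorem isSymmetricFor_inversion_dilation {a : ℝ} (ha : 0 < a) :
    IsSymmetricFor inversion (compAffine a 0 ha le_rfl) := by
  refine ⟨isConjugation_inversion, fun f => ext fun w hw => ?_⟩
  have ha0 : (a : ℂ) ≠ 0 := by exact_mod_cast ha.ne'
  have hw0 := ne_zero_of_mem_rhp hw
  have haw : a * w + 0 ∈ rightHalfPlane := HardyAux.affine_mem ha le_rfl hw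
  have hdiv : (1 / conj w - 0) / a = 1 / conj (a * w + 0) := by
    rw [sub_zero, add_zero, map_mul, Complex.conj_ofReal, div_div, mul_comm]
  rw [inversion_apply _ hw,
    adjoint_compAffine_apply ha Complex.zero_re _ (one_div_conj_mem_rhp hw), hdiv,
    inversion_apply _ (one_div_conj_mem_rhp haw), one_div_conj_one_div_conj,
    compAffine_apply _ _ _ hw]
  simp only [one_div, add_zero, map_mul, map_inv₀, mul_inv_rev, inv_inv, Complex.conj_ofReal,
    Complex.conj_conj]
  field_simp

end HardyH2

theorem corollary4p4 (a : ℝ) (ha : a ∈ Set.Ioo (0 : ℝ) 1 ∪ Set.Ioi 1) (b : ℂ) (hb : b.re = 0) :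
    ∃ W₀ : HardyH2 → HardyH2,
      (∀ (f : HardyH2), ∀ w ∈ rightHalfPlane,
        W₀ f w = 1 / w * (starRingEnd ℂ) (f (1 / (starRingEnd ℂ) w))) ∧
      let Cφ : HardyH2 →L[ℂ] HardyH2 := HardyH2.compAffine a b (pos_of_hyperbolic ha) hb.ge
      let Cτ : HardyH2 ≃L[ℂ] HardyH2 :=
        HardyH2.compTranslation (b / (1 - a)) (re_div_one_sub a hb)
      let W : HardyH2 → HardyH2 := Cτ.symm ∘ W₀ ∘ Cτ
      IsConjugation W ∧ IsSymmetricFor W Cφ := by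
  refine ⟨HardyH2.inversion, fun f w hw => HardyH2.inversion_apply f hw, ?_⟩
  intro Cφ Cτ W
  have one_sub_ne_zero : (1 - a : ℂ) ≠ 0 := by
    have : a ≠ 1 := ha.elim (fun h => h.2.ne) fun h => (mem_Ioi.1 h).ne'
    exact sub_ne_zero.2 (by exact_mod_cast this.symm)
  have fixed_point : a * (b / (1 - a)) + b = b / (1 - a) := by
    field_simp
    ring
  have hW : IsSymmetricFor W Cφ := by
    simp only [Cφ, HardyH2.compAffine_eq_symm_comp_dilation_comp (pos_of_hyperbolic ha) hb.ge
      (re_div_one_sub a hb) fixed_point]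
    exact (HardyH2.isSymmetricFor_inversion_dilation (pos_of_hyperbolic ha)).symm_comp_comp
      (HardyH2.compTranslationIsometry (b / (1 - a)) (re_div_one_sub a hb))
  exact ⟨hW.1, hW⟩
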